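/- Let $\mathbb{F}$ be an infinite field and let $L$ be a finite set of lines in $\mathbb{F}^2$. For every real $\epsilon>0$ and every natural number $N$ there exists a finite subset $Y\subseteq\mathbb{F}$ such that $|Y|\geq N$ and $|(Y\times Y)\cap\ell|\geq(1-\epsilon)|Y|$ for every line $\ell\in L$. -/

import Mathlib

open Classical in
/-- The Følner condition for commutative groups, by comparing polynomial and exponential growth. -/
@[to_additive /-- The Følner condition for commutative additive groups. -/]
theorem CommGroup.exists_card_filter_mul_notMem_le {G : Type*} [CommGroup G] (B : Finset G)
    {δ : ℝ} (hδ : 0 < δ) :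
    ∃ S : Finset G, S.Nonempty ∧
      ∀ b ∈ B, ((S.filter fun x => b * x ∉ S).card : ℝ) ≤ δ * S.card := by
  let S : ℕ → Finset G := fun n =>
    (Fintype.piFinset fun _ : B => Finset.range (n + 1)).image fun e => ∏ b : B, (b : G) ^ e b
  have hmem (n : ℕ) (e : B → ℕ) (he : ∀ b, e b ≤ n) : ∏ b : B, (b : G) ^ e b ∈ S n :=
    Finset.mem_image_of_mem _ (by
      rw [Fintype.mem_piFinset]
      intro b
      have := he b
      rw [Finset.mem_range]
      omega)
  have hS (n : ℕ) (x : G) (hx : x ∈ S n) :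
      ∃ e : B → ℕ, (∀ b, e b ≤ n) ∧ ∏ b : B, (b : G) ^ e b = x := by
    obtain ⟨e, he, rfl⟩ := Finset.mem_image.1 hx
    rw [Fintype.mem_piFinset] at he
    exact ⟨e, fun b => Nat.lt_succ_iff.1 (Finset.mem_range.1 (he b)), rfl⟩
  have hne (n : ℕ) : (S n).Nonempty := ⟨_, hmem n 0 fun _ => Nat.zero_le _⟩
  have hmono (n : ℕ) : S n ⊆ S (n + 1) := fun x hx => by
    obtain ⟨e, he, rfl⟩ := hS n x hx
    exact hmem _ e fun b => (he b).trans n.le_succ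
  have hmul (n : ℕ) (b : G) (hb : b ∈ B) (x : G) (hx : x ∈ S n) : b * x ∈ S (n + 1) := by
    obtain ⟨e, he, rfl⟩ := hS n x hx
    let f : B → ℕ := Pi.single ⟨b, hb⟩ 1
    have hf : ∏ c : B, (c : G) ^ f c = b := by
      rw [Finset.prod_eq_single (⟨b, hb⟩ : B) (fun c _ hc => by
        rw [show f c = 0 from Pi.single_eq_of_ne hc 1, pow_zero])
        (fun h => absurd (Finset.mem_univ _) h)]
      simp [f]
    have key : b * ∏ c : B, (c : G) ^ e c = ∏ c : B, (c : G) ^ (e c + f c) := by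
      simp only [pow_add, Finset.prod_mul_distrib, hf]
      exact mul_comm _ _
    rw [key]
    refine hmem (n + 1) (fun c => e c + f c) fun c => add_le_add (he c) ?_
    by_cases hc : c = ⟨b, hb⟩
    · subst hc
      simp [f]
    · simp [f, Pi.single_eq_of_ne hc]
  have hcard (n : ℕ) : (S n).card ≤ (n + 1) ^ B.card := by
    refine Finset.card_image_le.trans ?_
    simp [Fintype.card_piFinset]
  by_contra! hcon
  have hgrow (n : ℕ) : (1 + δ) * ((S n).card : ℝ) ≤ (S (n + 1)).card := by
    obtain ⟨b, hb, hlt⟩ := hcon (S n) (hne n)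
    have hdisj : Disjoint (S n) (((S n).filter fun x => b * x ∉ S n).image (b * ·)) := by
      rw [Finset.disjoint_right]
      intro y hy
      obtain ⟨x, hx, rfl⟩ := Finset.mem_image.1 hy
      exact (Finset.mem_filter.1 hx).2
    have hsub : S n ∪ ((S n).filter fun x => b * x ∉ S n).image (b * ·) ⊆ S (n + 1) := by
      refine Finset.union_subset (hmono n) fun y hy => ?_
      obtain ⟨x, hx, rfl⟩ := Finset.mem_image.1 hy
      exact hmul n b hb x (Finset.mem_filter.1 hx).1
    have hle := Finset.card_le_card hsub
    rw [Finset.card_union_of_disjoint hdisj,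
      Finset.card_image_of_injective _ (mul_right_injective b)] at hle
    have hle' : ((S n).card : ℝ) + ((S n).filter fun x => b * x ∉ S n).card ≤
        (S (n + 1)).card := by exact_mod_cast hle
    linarith
  have hexp (n : ℕ) : (1 + δ) ^ n ≤ ((S n).card : ℝ) := by
    induction n with
    | zero => simpa using Finset.card_pos.2 (hne 0)
    | succ n ih =>
      rw [pow_succ']
      exact (mul_le_mul_of_nonneg_left ih (by positivity)).trans (hgrow n)
  have hlim := (tendsto_pow_const_div_const_pow_of_one_lt B.card
    (lt_add_of_pos_right (1 : ℝ) hδ)).comp (Filter.tendsto_add_atTop_nat 1)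
  obtain ⟨n, hn⟩ := (hlim.eventually_lt_const (show (0 : ℝ) < (1 + δ)⁻¹ by positivity)).exists
  have h1 : (1 + δ) ^ n ≤ ((n : ℝ) + 1) ^ B.card := (hexp n).trans (by exact_mod_cast hcard n)
  simp only [Function.comp_apply] at hn
  rw [div_lt_iff₀ (by positivity), pow_succ', inv_mul_cancel_left₀ (by positivity)] at hn
  push_cast at hn
  linarith

section AffineMaps

variable {F : Type*} [Field F] [Infinite F]

/-- Finitely many distinct invertible affine maps `x ↦ m * (x + s)` separate some point `x`, and
their values there may be taken outside a given finite set. -/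
theorem exists_injOn_mul_add_notMem (E : Finset Fˣ) (S Z : Finset F) :
    ∃ x : F, Set.InjOn (fun p : Fˣ × F => (p.1 : F) * (x + p.2)) (E ×ˢ S : Finset (Fˣ × F)) ∧
      ∀ p ∈ E ×ˢ S, (p.1 : F) * (x + p.2) ∉ Z := by
  classical
  obtain ⟨x, hx⟩ := Infinite.exists_notMem_finset
    ((((E ×ˢ S) ×ˢ (E ×ˢ S)).image fun q : (Fˣ × F) × (Fˣ × F) =>
        ((q.2.1 : F) * q.2.2 - q.1.1 * q.1.2) / ((q.1.1 : F) - q.2.1)) ∪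
      ((E ×ˢ S) ×ˢ Z).image fun q : (Fˣ × F) × F => (q.1.1 : F)⁻¹ * q.2 - q.1.2)
  rw [Finset.mem_union, not_or] at hx
  refine ⟨x, ?_, fun p hp hZ => hx.2 (Finset.mem_image.2 ⟨(p, _), Finset.mk_mem_product hp hZ, ?_⟩)⟩
  · rintro ⟨m, s⟩ hp ⟨m', s'⟩ hp' h
    dsimp only at h
    by_cases hm : m = m'
    · subst hm
      have := add_left_cancel (mul_left_cancel₀ m.ne_zero h)
      rw [this]
    · refine absurd (Finset.mem_image.2 ⟨((m, s), (m', s')), Finset.mk_mem_product hp hp', ?_⟩) hx.1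
      have hne : (m : F) - m' ≠ 0 := sub_ne_zero.2 fun h => hm (Units.ext h)
      rw [div_eq_iff hne]
      linear_combination -h
  · simp

open Classical in
/-- A finite family of invertible affine maps of an infinite field has a nonempty finite almost
invariant set outside any given finite set. -/
theorem exists_nonempty_disjoint_almost_invariant (P : Finset (Fˣ × F)) (Z : Finset F) {δ : ℝ}
    (hδ : 0 < δ) :
    ∃ Y : Finset F, Y.Nonempty ∧ Disjoint Y Z ∧
      ∀ p ∈ P, ((Y.filter fun x => (p.1 : F) * x + p.2 ∉ Y).card : ℝ) ≤ δ * Y.card := by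
  obtain ⟨E, hE, hEB⟩ :=
    CommGroup.exists_card_filter_mul_notMem_le (P.image Prod.fst) (half_pos hδ)
  obtain ⟨S, hS, hSB⟩ := AddCommGroup.exists_card_filter_add_notMem_le
    ((E ×ˢ P).image fun q => ((q.2.1 : F) * q.1)⁻¹ * q.2.2) (half_pos hδ)
  obtain ⟨x, hinj, hZ⟩ := exists_injOn_mul_add_notMem E S Z
  refine ⟨(E ×ˢ S).image fun p : Fˣ × F => (p.1 : F) * (x + p.2), (hE.product hS).image _, ?_, ?_⟩
  · rw [Finset.disjoint_left]
    intro y hy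
    obtain ⟨p, hp, rfl⟩ := Finset.mem_image.1 hy
    exact hZ p hp
  rintro ⟨a, b⟩ hab
  rw [Finset.card_image_of_injOn hinj, Finset.card_product]
  set E' := E.filter fun m => a * m ∉ E
  set S' : Fˣ → Finset F := fun m => S.filter fun s => ((a : F) * m)⁻¹ * b + s ∉ S
  have hE' : (E'.card : ℝ) ≤ δ / 2 * E.card := by
    convert hEB a (Finset.mem_image_of_mem Prod.fst hab)
  have hS' (m : Fˣ) (hm : m ∈ E) : ((S' m).card : ℝ) ≤ δ / 2 * S.card :=
    hSB _ (Finset.mem_image.2 ⟨(m, (a, b)), Finset.mk_mem_product hm hab, rfl⟩)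
  have hsub : (((E ×ˢ S).image fun p : Fˣ × F => (p.1 : F) * (x + p.2)).filter fun y =>
        (a : F) * y + b ∉ (E ×ˢ S).image fun p : Fˣ × F => (p.1 : F) * (x + p.2)) ⊆
      (E' ×ˢ S ∪ (E.sigma S').image fun q => (q.1, q.2)).image
        fun p : Fˣ × F => (p.1 : F) * (x + p.2) := by
    intro y hy
    obtain ⟨hy, hbad⟩ := Finset.mem_filter.1 hy
    obtain ⟨⟨m, s⟩, hp, rfl⟩ := Finset.mem_image.1 hy
    obtain ⟨hm, hs⟩ := Finset.mem_product.1 hp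
    refine Finset.mem_image_of_mem (fun p : Fˣ × F => (p.1 : F) * (x + p.2)) ?_
    rw [Finset.mem_union]
    by_cases ham : a * m ∈ E
    · refine Or.inr (Finset.mem_image.2 ⟨⟨m, s⟩, Finset.mem_sigma.2 ⟨hm, ?_⟩, rfl⟩)
      refine Finset.mem_filter.2 ⟨hs, fun hs' => hbad (Finset.mem_image.2
        ⟨(a * m, _), Finset.mk_mem_product ham hs', ?_⟩)⟩
      have ha : (a : F) ≠ 0 := a.ne_zero
      have hm0 : (m : F) ≠ 0 := m.ne_zero
      push_cast
      field_simp
      ring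
    · exact Or.inl (Finset.mk_mem_product (Finset.mem_filter.2 ⟨hm, ham⟩) hs)
  have hcard := (Finset.card_le_card hsub).trans (Finset.card_image_le.trans
    ((Finset.card_union_le _ _).trans (Nat.add_le_add_left Finset.card_image_le _)))
  rw [Finset.card_product, Finset.card_sigma] at hcard
  have hsum : ∑ m ∈ E, ((S' m).card : ℝ) ≤ E.card * (δ / 2 * S.card) := by
    rw [← nsmul_eq_mul]
    exact Finset.sum_le_card_nsmul _ _ _ hS'
  have hprod := mul_le_mul_of_nonneg_right hE' (Nat.cast_nonneg (α := ℝ) S.card)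
  refine (Nat.cast_le (α := ℝ).2 hcard).trans ?_
  push_cast
  linarith

open Classical in
/-- A finite family of invertible affine maps of an infinite field has arbitrarily large finite
almost invariant sets. -/
theorem exists_le_card_almost_invariant (P : Finset (Fˣ × F)) {δ : ℝ} (hδ : 0 < δ) (N : ℕ) :
    ∃ Y : Finset F, N ≤ Y.card ∧
      ∀ p ∈ P, ((Y.filter fun x => (p.1 : F) * x + p.2 ∉ Y).card : ℝ) ≤ δ * Y.card := by
  induction N with
  | zero => exact ⟨∅, by simp⟩
  | succ N ih =>
    obtain ⟨Z, hN, hZ⟩ := ih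
    obtain ⟨Y, hne, hdisj, hY⟩ := exists_nonempty_disjoint_almost_invariant P Z hδ
    refine ⟨Y ∪ Z, ?_, fun p hp => ?_⟩
    · rw [Finset.card_union_of_disjoint hdisj]
      have := hne.card_pos
      omega
    · have hsub : ((Y ∪ Z).filter fun x => (p.1 : F) * x + p.2 ∉ Y ∪ Z) ⊆
          (Y.filter fun x => (p.1 : F) * x + p.2 ∉ Y) ∪
            Z.filter fun x => (p.1 : F) * x + p.2 ∉ Z := by
        intro x
        simp only [Finset.mem_filter, Finset.mem_union]
        tauto
      have hcard := Nat.cast_le (α := ℝ).2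
        ((Finset.card_le_card hsub).trans (Finset.card_union_le _ _))
      rw [Finset.card_union_of_disjoint hdisj]
      push_cast at hcard ⊢
      linarith [hY p hp, hZ p hp]

end AffineMaps

/-- A line in the plane contains a vertical line, a horizontal line, or the graph of an invertible
affine map. -/
theorem AffineSubspace.exists_vertical_or_horizontal_or_graph {F : Type*} [Field F]
    (l : AffineSubspace F (F × F)) (hl : Module.finrank F l.direction = 1) :
    ∃ (c : F) (a : Fˣ) (b : F),
      (∀ y, (c, y) ∈ l) ∨ (∀ x, (x, c) ∈ l) ∨ ∀ x, (x, (a : F) * x + b) ∈ l := by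
  have hne : (l : Set (F × F)).Nonempty := by
    rw [AffineSubspace.nonempty_iff_ne_bot]
    rintro rfl
    rw [AffineSubspace.direction_bot, finrank_bot] at hl
    exact zero_ne_one hl
  obtain ⟨⟨p, q⟩, hp⟩ := hne
  obtain ⟨v, hv0, -⟩ := finrank_eq_one_iff'.1 hl
  obtain ⟨⟨u, w⟩, hv⟩ := v
  have hmem (t : F) : (t * u + p, t * w + q) ∈ l := by
    simpa using AffineSubspace.vadd_mem_of_mem_direction (l.direction.smul_mem t hv) hp
  by_cases hu : u = 0
  · have hw : w ≠ 0 := by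
      rintro rfl
      exact hv0 (by simp [hu])
    refine ⟨p, 1, 0, Or.inl fun y => ?_⟩
    simpa [hu, hw] using hmem ((y - q) / w)
  by_cases hw : w = 0
  · refine ⟨q, 1, 0, Or.inr (Or.inl fun x => ?_)⟩
    simpa [hu, hw] using hmem ((x - p) / u)
  refine ⟨0, Units.mk0 (w / u) (div_ne_zero hw hu), q - w / u * p, Or.inr (Or.inr fun x => ?_)⟩
  convert hmem ((x - p) / u) using 2
  · field_simp
    ring
  · rw [Units.val_mk0]
    field_simp
    ring

/-- Any finite set `L` of lines (one-dimensional affine subspaces, of any direction) in the plane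
over an infinite field is `(1 - ε)`-rich in some arbitrarily large finite grid `Y × Y`. -/
theorem theorem444414 {F : Type*} [Field F] [Infinite F]
    (L : Set (AffineSubspace F (F × F))) (hL : L.Finite)
    (hline : ∀ l ∈ L, Module.finrank F l.direction = 1)
    (ε : ℝ) (hε : 0 < ε) (N : ℕ) :
    ∃ Y : Finset F, N ≤ Y.card ∧
      ∀ l ∈ L, (1 - ε) * (Y.card : ℝ) ≤
        ((((Y : Set F) ×ˢ (Y : Set F)) ∩ (l : Set (F × F))).ncard : ℝ) := by
  classical
  choose! c a b h using fun l hl =>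
    AffineSubspace.exists_vertical_or_horizontal_or_graph l (hline l hl)
  set C : Finset F := hL.toFinset.image c
  obtain ⟨M, hM⟩ := exists_nat_ge (C.card / (ε / 2))
  rw [div_le_iff₀ (half_pos hε)] at hM
  obtain ⟨Y, hN, hY⟩ := exists_le_card_almost_invariant
    (hL.toFinset.image fun l => (a l, b l)) (half_pos hε) (max N M)
  have hYC : Y.card ≤ (Y ∪ C).card := Finset.card_le_card Finset.subset_union_left
  refine ⟨Y ∪ C, (le_max_left N M).trans (hN.trans hYC), fun l hl => ?_⟩
  have hcl : c l ∈ Y ∪ C :=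
    Finset.mem_union_right _ (Finset.mem_image_of_mem c (hL.mem_toFinset.2 hl))
  have hcount (g : F → F × F) (hg : Function.Injective g) (T : Finset F)
      (hT : ∀ x ∈ T, g x ∈ (((Y ∪ C : Finset F) : Set F) ×ˢ ((Y ∪ C : Finset F) : Set F)) ∩
        (l : Set (F × F))) :
      (T.card : ℝ) ≤ (((((Y ∪ C : Finset F) : Set F) ×ˢ ((Y ∪ C : Finset F) : Set F)) ∩
        (l : Set (F × F))).ncard : ℝ) := by
    rw [← Finset.card_image_of_injective T hg, ← Set.ncard_coe_finset, Nat.cast_le]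
    refine Set.ncard_le_ncard ?_
      (((Finset.finite_toSet _).prod (Finset.finite_toSet _)).inter_of_left _)
    intro z hz
    obtain ⟨x, hx, rfl⟩ := Finset.mem_image.1 (Finset.mem_coe.1 hz)
    exact hT x hx
  have htriv : (1 - ε) * ((Y ∪ C).card : ℝ) ≤ (Y ∪ C).card :=
    mul_le_of_le_one_left (Nat.cast_nonneg _) (by linarith)
  rcases h l hl with hv | hh | hg
  · exact htriv.trans (hcount (fun y => (c l, y)) (fun _ _ h => (Prod.mk.inj h).2) _
      fun y hy => ⟨⟨hcl, hy⟩, hv y⟩)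
  · exact htriv.trans (hcount (fun x => (x, c l)) (fun _ _ h => (Prod.mk.inj h).1) _
      fun x hx => ⟨⟨hx, hcl⟩, hh x⟩)
  · have hgood := hcount (fun x => (x, (a l : F) * x + b l)) (fun _ _ h => (Prod.mk.inj h).1)
      ((Y ∪ C).filter fun x => (a l : F) * x + b l ∈ Y ∪ C)
      fun x hx => ⟨⟨(Finset.mem_filter.1 hx).1, (Finset.mem_filter.1 hx).2⟩, hg x⟩
    refine le_trans ?_ hgood
    have hsplit := Finset.card_filter_add_card_filter_not (s := Y ∪ C)
      (fun x => (a l : F) * x + b l ∈ Y ∪ C)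
    have hsub : ((Y ∪ C).filter fun x => (a l : F) * x + b l ∉ Y ∪ C) ⊆
        (Y.filter fun x => (a l : F) * x + b l ∉ Y) ∪ C := by
      intro x
      simp only [Finset.mem_filter, Finset.mem_union]
      tauto
    have hcard := (Finset.card_le_card hsub).trans (Finset.card_union_le _ _)
    have hbad := hY (a l, b l) (Finset.mem_image_of_mem _ (hL.mem_toFinset.2 hl))
    have hMY : (M : ℝ) ≤ Y.card := Nat.cast_le.2 ((le_max_right N M).trans hN)
    have hMY' := mul_le_mul_of_nonneg_right hMY (half_pos hε).le
    have hYC' := mul_le_mul_of_nonneg_left (Nat.cast_le (α := ℝ).2 hYC) hε.le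
    rify at hsplit hcard
    simp only at hbad
    linarith
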